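/- There is an absolute constant $c>0$ with the following property. For $k\in\mathbb N$ and a unit roundoff $u\ge 0$ with $cku<1$ put $\widetilde\gamma_k(u)=\frac{cku}{1-cku}$. All norms are spectral norms, $M^\dagger$ is the Moore–Penrose pseudoinverse of $M$, and $\kappa_2(M)=\|M\|_2\|M^\dagger\|_2$. Let $A,E\in\mathbb R^{m\times n}$ and $A_s=A+E$ with $\|E\|_2\le\sqrt n\,u_s\|A\|_2$, where $u_s\ge0$; thus $A_s$ plays the role of $A$ cast to a precision with unit roundoff $u_s$. Let $\Omega\in\mathbb R^{s\times m}$ with $s\ge n$. Suppose that $A$, $A_s$ and $\Omega A_s$ have full column rank $n$, and let $\Omega A_s=Q_sR_s$ be an economic QR decomposition ($Q_s\in\mathbb R^{s\times n}$ with orthonormal columns, $R_s\in\mathbb R^{n\times n}$ upper triangular). Let $\widehat Y=\Omega A_s+\Delta_s$ be the computed sketch, where $\Delta_s\in\mathbb R^{s\times n}$ is the error made in computing it, and let $\widehat R$ be an $R$-factor of $\widehat Y$ computed by Householder QR in floating point arithmetic with unit roundoff $u_{QR}\ge0$ under the standard model: each operation $+,-,\times,/,\sqrt{\ }$ with exact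 result $x$ returns $x(1+\delta)$ for some $|\delta|\le u_{QR}$ (no overflow or underflow), and the additions in inner products are made in any order. In the $k$-th step the reflector $I-b\,vv^T$ is formed from the part $x$ of the current $k$-th column on and below the diagonal by $\sigma=\operatorname{sign}(x_1)\|x\|_2$ (with $\operatorname{sign}(0)=1$), $v=x+\sigma e_1$, $b=1/(\sigma v_1)$; the pivot column becomes $-\sigma e_1$, and each column $y$ to the right becomes $y-(b\,(v^Ty))v$. If the entries of $x$ below the diagonal already vanish, the reflector may be taken to be the identity (and is so if $x=0$). Assume $c\,sn\,u_{QR}<1$ and $$(2\log_2 n+4)\,n^{1/2}\,\widetilde\gamma_{sn}(u_{QR})\,\kappa_2(\widehat Y)<1,\qquad (2\log_2 n+4)\,n^{1/2}\,\|(\Omega A_s)^\dagger\|_2\,\|\Delta_s\|_2<1,$$ and put $$\beta_s=\bigl(1+18(2\log_2 n+4)n^{1/2}\,\widetilde\gamma_{sn}(u_{QR})\,\kappa_2(\Omega A_s)\bigr)\bigl(1+2(2\log_2 n+4)n^{1/2}\,\|(\Omega A_s)^\dagger\|_2\|\Delta_s\|_2\bigr).$$ Then $R_s$ and $\widehat R$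 are invertible and $$\|\widehat R\|_2\le\beta_s\|\Omega A_s\|_2,\qquad \|\widehat R^{-1}\|_2\le\beta_s\|(\Omega A_s)^\dagger\|_2,\qquad \kappa_2(\widehat R)\le\beta_s^2\,\kappa_2(\Omega A_s),$$ $$\|A\widehat R^{-1}\|_2\le\beta_s\|AR_s^{-1}\|_2,\qquad \|(A\widehat R^{-1})^\dagger\|_2\le\beta_s\|(AR_s^{-1})^\dagger\|_2,\qquad \kappa_2(A\widehat R^{-1})\le\beta_s^2\,\kappa_2(AR_s^{-1}).$$ -/

import Mathlib

open scoped Matrix Matrix.Norms.L2Operator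

namespace SketchQR

/-! Throughout, `‖M‖` is the spectral norm of a real matrix (the operator norm with respect to
the Euclidean norms). -/

/-- The four Penrose conditions: `X` is the Moore-Penrose pseudoinverse of the real matrix `M`. -/
structure IsMoorePenrose {p q : ℕ} (M : Matrix (Fin p) (Fin q) ℝ)
    (X : Matrix (Fin q) (Fin p) ℝ) : Prop where
  mul_mul_self : M * X * M = M
  self_mul_mul : X * M * X = X
  symm_left : (M * X)ᵀ = M * X
  symm_right : (X * M)ᵀ = X * M

/-- Every real matrix has a Moore-Penrose pseudoinverse. -/
theorem exists_isMoorePenrose {p q : ℕ} (M : Matrix (Fin p) (Fin q) ℝ) :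
    ∃ X, IsMoorePenrose M X := by
  obtain ⟨U, d, hU, hH⟩ : ∃ (U : Matrix (Fin q) (Fin q) ℝ) (d : Fin q → ℝ),
      Uᵀ * U = 1 ∧ Mᵀ * M = U * Matrix.diagonal d * Uᵀ := by
    have hM : (Mᵀ * M).IsHermitian := by
      simpa [Matrix.conjTranspose_eq_transpose_of_trivial] using
        Matrix.isHermitian_conjTranspose_mul_self M
    refine ⟨hM.eigenvectorUnitary, hM.eigenvalues, ?_, ?_⟩
    · have h := Matrix.mem_unitaryGroup_iff'.mp hM.eigenvectorUnitary.2
      simpa [Matrix.star_eq_conjTranspose, Matrix.conjTranspose_eq_transpose_of_trivial] using h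
    · have h := hM.spectral_theorem
      rw [Unitary.conjStarAlgAut_apply] at h
      simpa [Matrix.star_eq_conjTranspose, Matrix.conjTranspose_eq_transpose_of_trivial,
        Function.comp_def] using h
  set G : Matrix (Fin q) (Fin q) ℝ := Matrix.diagonal (fun i => (d i)⁻¹) with hG
  have hDGD : Matrix.diagonal d * G * Matrix.diagonal d = Matrix.diagonal d := by
    simp only [hG, Matrix.diagonal_mul_diagonal]
    congr 1; funext i; by_cases h : d i = 0 <;> simp [h]
  have hGDG : G * Matrix.diagonal d * G = G := by
    simp only [hG, Matrix.diagonal_mul_diagonal]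
    congr 1; funext i; by_cases h : d i = 0 <;> simp [h]
  have hGD : G * Matrix.diagonal d = Matrix.diagonal d * G := by
    simp only [hG, Matrix.diagonal_mul_diagonal]
    congr 1; funext i; ring
  obtain ⟨N, hN⟩ : ∃ N, N = U * G * Uᵀ := ⟨_, rfl⟩
  obtain ⟨H, hH'⟩ : ∃ H, H = Mᵀ * M := ⟨_, rfl⟩
  rw [← hH'] at hH
  have hNt : Nᵀ = N := by
    simp [hN, hG, Matrix.transpose_mul, Matrix.mul_assoc]
  have hHt : Hᵀ = H := by rw [hH', Matrix.transpose_mul, Matrix.transpose_transpose]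
  have mid (B C : Matrix (Fin q) (Fin q) ℝ) :
      U * B * Uᵀ * (U * C * Uᵀ) = U * (B * C) * Uᵀ := by
    calc U * B * Uᵀ * (U * C * Uᵀ) = U * B * (Uᵀ * U) * C * Uᵀ := by
          simp only [Matrix.mul_assoc]
      _ = U * (B * C) * Uᵀ := by rw [hU, Matrix.mul_one, Matrix.mul_assoc U]
  have hHNH : H * N * H = H := by rw [hH, hN, mid, mid, hDGD]
  have hNHN : N * H * N = N := by rw [hH, hN, mid, mid, hGDG]
  have hcomm : N * H = H * N := by rw [hH, hN, mid, mid, hGD]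
  have hM : M * (N * H) = M := by
    have h0 : (M * (N * H) - M)ᵀ * (M * (N * H) - M) = 0 := by
      have e1 : (M * (N * H))ᵀ = H * N * Mᵀ := by
        rw [Matrix.transpose_mul, Matrix.transpose_mul, hNt, hHt]
      rw [Matrix.transpose_sub, e1, Matrix.sub_mul, Matrix.mul_sub, Matrix.mul_sub]
      have a1 : H * N * Mᵀ * (M * (N * H)) = H := by
        calc _ = H * N * (Mᵀ * M) * (N * H) := by simp only [Matrix.mul_assoc]
          _ = H := by rw [← hH', hHNH, ← Matrix.mul_assoc, hHNH]
      have a2 : H * N * Mᵀ * M = H := by rw [Matrix.mul_assoc, ← hH', hHNH]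
      have a3 : Mᵀ * (M * (N * H)) = H := by
        rw [← Matrix.mul_assoc, ← hH', ← Matrix.mul_assoc, hHNH]
      rw [a1, a2, a3, ← hH']; simp
    have h1 : (M * (N * H) - M) = 0 := by
      rw [← Matrix.conjTranspose_mul_self_eq_zero,
        Matrix.conjTranspose_eq_transpose_of_trivial]
      exact h0
    exact sub_eq_zero.mp h1
  refine ⟨N * Mᵀ, ⟨?_, ?_, ?_, ?_⟩⟩
  · rw [Matrix.mul_assoc, Matrix.mul_assoc N, ← hH', hM]
  · rw [Matrix.mul_assoc N Mᵀ M, ← hH', ← Matrix.mul_assoc, hNHN]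
  · rw [Matrix.transpose_mul, Matrix.transpose_mul, hNt, Matrix.transpose_transpose,
      Matrix.mul_assoc]
  · rw [Matrix.mul_assoc, ← hH', Matrix.transpose_mul, hNt, hHt, hcomm]

/-- The Moore-Penrose pseudoinverse is unique. -/
theorem IsMoorePenrose.unique {p q : ℕ} {M : Matrix (Fin p) (Fin q) ℝ}
    {X Y : Matrix (Fin q) (Fin p) ℝ} (hX : IsMoorePenrose M X) (hY : IsMoorePenrose M Y) :
    X = Y := by
  have h1 : M * X = M * Y := by
    calc M * X = (M * Y * M * X)ᵀᵀ := by rw [hY.mul_mul_self, Matrix.transpose_transpose]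
      _ = ((M * X)ᵀ * (M * Y)ᵀ)ᵀ := by
          rw [Matrix.mul_assoc (M * Y) M X, Matrix.transpose_mul]
      _ = (M * X * M * Y)ᵀ := by rw [hX.symm_left, hY.symm_left, ← Matrix.mul_assoc]
      _ = M * Y := by rw [hX.mul_mul_self, hY.symm_left]
  have h2 : X * M = Y * M := by
    calc X * M = (X * (M * Y * M))ᵀᵀ := by rw [hY.mul_mul_self, Matrix.transpose_transpose]
      _ = ((Y * M)ᵀ * (X * M)ᵀ)ᵀ := by
          rw [← Matrix.transpose_mul]; simp only [Matrix.mul_assoc]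
      _ = (Y * (M * X * M))ᵀ := by
          rw [hX.symm_right, hY.symm_right]; simp only [Matrix.mul_assoc]
      _ = Y * M := by rw [hX.mul_mul_self, hY.symm_right]
  calc X = X * M * X := hX.self_mul_mul.symm
    _ = Y * (M * X) := by rw [h2, Matrix.mul_assoc]
    _ = Y := by rw [h1, ← Matrix.mul_assoc, hY.self_mul_mul]
/-- The Moore-Penrose pseudoinverse of a real matrix. -/
noncomputable def pinv {p q : ℕ} (M : Matrix (Fin p) (Fin q) ℝ) : Matrix (Fin q) (Fin p) ℝ :=
  (exists_isMoorePenrose M).choose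

/-- `pinv M` satisfies the Penrose conditions. -/
theorem pinv_spec {p q : ℕ} (M : Matrix (Fin p) (Fin q) ℝ) : IsMoorePenrose M (pinv M) :=
  (exists_isMoorePenrose M).choose_spec

/-- The spectral condition number `κ₂(M) = ‖M‖₂ ‖M†‖₂`. -/
noncomputable def cond2 {p q : ℕ} (M : Matrix (Fin p) (Fin q) ℝ) : ℝ := ‖M‖ * ‖pinv M‖

/-- `M = Q R` is an economic QR decomposition of the `p × q` matrix `M`: the `p × q` factor `Q` has
orthonormal columns and the `q × q` factor `R` is upper triangular. -/
structure IsEconomicQR {p q : ℕ} (M Q : Matrix (Fin p) (Fin q) ℝ)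
    (R : Matrix (Fin q) (Fin q) ℝ) : Prop where
  eq_mul : M = Q * R
  orthonormal : Qᵀ * Q = 1
  upper : ∀ i j, j < i → R i j = 0

/-! ### Floating point arithmetic: the standard model

A computation is described by the relation between its data and its possible computed results, so
that every arithmetic that obeys the standard model is covered. -/

/-- Standard model with unit roundoff `u`: an operation (`+`, `-`, `*`, `/` or `√`) with exact
result `x` may return `y = x (1 + δ)` with `|δ| ≤ u`. -/
def Rounds (u x y : ℝ) : Prop := ∃ δ : ℝ, |δ| ≤ u ∧ y = x * (1 + δ)

/-- `FlSum u S t`: `t` is a possible computed value of the sum of the nonempty multiset `S` of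
numbers, the additions being done in any order. -/
inductive FlSum (u : ℝ) : Multiset ℝ → ℝ → Prop
  | single (x : ℝ) : FlSum u {x} x
  | add {S T : Multiset ℝ} {a b c : ℝ} (hS : FlSum u S a) (hT : FlSum u T b)
      (hc : Rounds u (a + b) c) : FlSum u (S + T) c

/-- `FlDot u r x y t`: `t` is a possible computed value of `∑_{i ≥ r} x i * y i`. -/
def FlDot {s : ℕ} (u : ℝ) (r : Fin s) (x y : Fin s → ℝ) (t : ℝ) : Prop :=
  ∃ p : Fin s → ℝ, (∀ i, r ≤ i → Rounds u (x i * y i) (p i)) ∧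
    FlSum u ((Finset.Ici r).val.map p) t

/-! ### Householder QR in floating point arithmetic -/

/-- Computed Householder data for the entries `x r, x (r+1), …` of a column `x`: in exact arithmetic
`σ = sign (x r) ‖(x i)_{i ≥ r}‖₂`, `v = x + σ e_r` on the indices `≥ r` and `b = 1 / (σ v_r)`; the
reflector is `I - b v vᵀ`, and it maps those entries to `-σ e_r`. -/
def FlHouseholderVector {s : ℕ} (u : ℝ) (r : Fin s) (x v : Fin s → ℝ) (b σ : ℝ) : Prop :=
  (∃ d ρ : ℝ, FlDot u r x x d ∧ Rounds u (Real.sqrt d) ρ ∧ σ = if 0 ≤ x r then ρ else -ρ) ∧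
  Rounds u (x r + σ) (v r) ∧ (∀ i, r < i → v i = x i) ∧
  ∃ w : ℝ, Rounds u (σ * v r) w ∧ Rounds u (1 / w) b

/-- Computed application of the reflector `I - b v vᵀ`, which acts on the indices `≥ r`, to the
column `y`: the result is `y' = y - τ v` with `τ = b (vᵀ y)`. -/
def FlApplyReflector {s : ℕ} (u : ℝ) (r : Fin s) (v : Fin s → ℝ) (b : ℝ)
    (y y' : Fin s → ℝ) : Prop :=
  ∃ t τ : ℝ, FlDot u r v y t ∧ Rounds u (b * t) τ ∧
    (∀ i, i < r → y' i = y i) ∧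
    ∀ i, r ≤ i → ∃ p : ℝ, Rounds u (τ * v i) p ∧ Rounds u (y i - p) (y' i)

/-- One step of Householder QR, with pivot position (row `r`, column `k`), takes `Z` to `Z'`.
If the entries below the pivot are already zero (in particular if there are none), the reflector
may be taken to be the identity. Otherwise a reflector is computed from column `k`; the pivot column
is set to its known image, and the reflector is applied to the columns on the right. -/
def HouseholderStep {s n : ℕ} (u : ℝ) (r : Fin s) (k : Fin n)
    (Z Z' : Matrix (Fin s) (Fin n) ℝ) : Prop :=
  ((∀ i, r < i → Z i k = 0) ∧ Z' = Z) ∨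
  ((∃ i, r ≤ i ∧ Z i k ≠ 0) ∧
    ∃ (v : Fin s → ℝ) (b σ : ℝ), FlHouseholderVector u r (fun i => Z i k) v b σ ∧
      (∀ j, j < k → ∀ i, Z' i j = Z i j) ∧
      (∀ i, i < r → Z' i k = Z i k) ∧ Z' r k = -σ ∧ (∀ i, r < i → Z' i k = 0) ∧
      ∀ j, k < j → FlApplyReflector u r v b (fun i => Z i j) (fun i => Z' i j))

/-- `Rh` is a possible computed `R`-factor of the `s × n` matrix `Y` (where `n ≤ s`): the leading
`n × n` block of the result of the `n` steps of Householder QR in floating point arithmetic with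
unit roundoff `u`. -/
def IsComputedRFactor {s n : ℕ} (hns : n ≤ s) (u : ℝ) (Y : Matrix (Fin s) (Fin n) ℝ)
    (Rh : Matrix (Fin n) (Fin n) ℝ) : Prop :=
  ∃ Z : ℕ → Matrix (Fin s) (Fin n) ℝ, Z 0 = Y ∧
    (∀ k : Fin n, HouseholderStep u (Fin.castLE hns k) k (Z k) (Z (k + 1))) ∧
    Rh = (Z n).submatrix (Fin.castLE hns) id

/-! ### The quantities in the bounds -/

/-- `γ̃_k = c k u / (1 - c k u)`, used only when `c k u < 1`. -/
noncomputable def gammaTilde (c : ℝ) (k : ℕ) (u : ℝ) : ℝ := c * k * u / (1 - c * k * u)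

/-- The factor `(2 log₂ n + 4) n^{1/2}`. -/
noncomputable def logFactor (n : ℕ) : ℝ := (2 * Real.logb 2 n + 4) * Real.sqrt n

/-- The amplification factor `β` of a sketched matrix `Y` (an `s × n` matrix) whose computed version
is `Y + Δ`, when the QR step has unit roundoff `u`. -/
noncomputable def amplification {s n : ℕ} (c u : ℝ) (Y Δ : Matrix (Fin s) (Fin n) ℝ) : ℝ :=
  (1 + 18 * logFactor n * gammaTilde c (s * n) u * cond2 Y) *
    (1 + 2 * logFactor n * ‖pinv Y‖ * ‖Δ‖)

end SketchQR

namespace SketchQR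

/-! ### Rounding errors of scalar computations -/

/-! Write `Y = Ω A_s`. Everything reduces to one two-sided comparison: for every `z`, `‖R̂ z‖` and
`‖Y z‖` agree up to the factor `β_s` in both directions. Since `Q_s` has orthonormal columns, `‖R_s
z‖ = ‖Y z‖`, so `R_s` and `R̂` are comparable too. Spectral norms, and norms of pseudoinverses of
injective matrices, are the best constants in inequalities between `‖z‖` and `‖M z‖`; hence all the
bounds follow, those for `A R̂⁻¹` by the substitution `z = R̂⁻¹ w`.

The comparison passes through `Ŷ = Y + Δ_s`. From `Y` to `Ŷ` the relative change of `‖Y z‖` is at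
most `‖Y†‖ ‖Δ_s‖`. From `Ŷ` to `R̂` a backward error analysis is needed. The sign of `σ` excludes
cancellation in `v_r` (`FlHouseholderVector.accuracy`), so each computed step is columnwise within a
relative `O(su)` of an exact reflection (`HouseholderStep.exists_isometry`). Reflections preserve
norms, so the errors add up over `n` steps to `O(snu) √n ‖Ŷ‖ ‖z‖`
(`IsComputedRFactor.abs_norm_sub_norm_le`), which is `O(snu) √n κ₂(Ŷ)` relative to `‖Ŷ z‖`.
`norm_comparison` combines the two errors. -/

theorem Rounds.abs_sub_le {u x y : ℝ} (h : Rounds u x y) : |y - x| ≤ u * |x| := by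
  obtain ⟨δ, hδ, rfl⟩ := h
  have : x * (1 + δ) - x = δ * x := by ring
  rw [this, abs_mul]
  exact mul_le_mul_of_nonneg_right hδ (abs_nonneg x)

/-- Errors of products, relative to bounds of the factors. -/
theorem abs_mul_sub_mul_le {a a' b b' A B α β : ℝ} (ha : |a| ≤ A) (ha' : |a' - a| ≤ α * A)
    (hb : |b| ≤ B) (hb' : |b' - b| ≤ β * B) :
    |a' * b' - a * b| ≤ (α + β + α * β) * (A * B) := by
  have e : a' * b' - a * b = (a' - a) * b + a * (b' - b) + (a' - a) * (b' - b) := by ring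
  have h1 : |(a' - a) * b| ≤ (α * A) * B := by
    rw [abs_mul]; exact mul_le_mul ha' hb (abs_nonneg _) ((abs_nonneg _).trans ha')
  have h2 : |a * (b' - b)| ≤ A * (β * B) := by
    rw [abs_mul]; exact mul_le_mul ha hb' (abs_nonneg _) ((abs_nonneg _).trans ha)
  have h3 : |(a' - a) * (b' - b)| ≤ (α * A) * (β * B) := by
    rw [abs_mul]; exact mul_le_mul ha' hb' (abs_nonneg _) ((abs_nonneg _).trans ha')
  rw [e]
  refine (abs_add_three _ _ _).trans ?_
  linarith

/-- A rounding on top of an error `α`, relative to a bound `A` of the exact value. -/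
theorem Rounds.abs_sub_le_of_le {u a a' c A α : ℝ} (h : Rounds u a' c) (ha : |a| ≤ A)
    (ha' : |a' - a| ≤ α * A) : |c - a| ≤ (α + u + α * u) * A := by
  obtain ⟨δ, hδ, rfl⟩ := h
  simpa using abs_mul_sub_mul_le (b := 1) (b' := 1 + δ) (B := 1) (β := u) ha ha' (by simp)
    (by simpa using hδ)

theorem FlSum.card_pos {u : ℝ} {S : Multiset ℝ} {t : ℝ} (h : FlSum u S t) :
    0 < Multiset.card S := by
  induction h with
  | single x => simp
  | add hS hT hc ihS ihT => rw [Multiset.card_add]; omega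

/-- Whatever the order of the additions, a summand takes part in at most `card S - 1` of them.
Leaving `k` free above `card S - 1` lets both halves of a sum use the same exponent; the bound on
the exact sum is carried along because the next rounding is measured against it. -/
theorem FlSum.abs_sub_sum_le {u : ℝ} (hu : 0 ≤ u) {S : Multiset ℝ} {t : ℝ} (h : FlSum u S t) :
    ∀ k : ℕ, Multiset.card S ≤ k + 1 →
      |t - S.sum| ≤ ((1 + u) ^ k - 1) * (S.map (fun x => |x|)).sum ∧
        |S.sum| ≤ (S.map (fun x => |x|)).sum := by
  induction h with
  | single x =>
    intro k _
    have : 1 ≤ (1 + u) ^ k := one_le_pow₀ (by linarith)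
    simpa using mul_nonneg (sub_nonneg.2 this) (abs_nonneg x)
  | @add S T a b c hS hT hc ihS ihT =>
    intro k hk
    have h1 := hS.card_pos
    have h2 := hT.card_pos
    rw [Multiset.card_add] at hk
    obtain ⟨l, rfl⟩ : ∃ l, k = l + 1 := ⟨k - 1, by omega⟩
    obtain ⟨e1, f1⟩ := ihS l (by omega)
    obtain ⟨e2, f2⟩ := ihT l (by omega)
    rw [Multiset.map_add, Multiset.sum_add, Multiset.sum_add]
    have f : |S.sum + T.sum| ≤ (S.map (fun x => |x|)).sum + (T.map (fun x => |x|)).sum :=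
      (abs_add_le _ _).trans (add_le_add f1 f2)
    refine ⟨?_, f⟩
    have e : |a + b - (S.sum + T.sum)| ≤
        ((1 + u) ^ l - 1) * ((S.map (fun x => |x|)).sum + (T.map (fun x => |x|)).sum) := by
      rw [add_sub_add_comm, mul_add]
      exact (abs_add_le _ _).trans (add_le_add e1 e2)
    convert hc.abs_sub_le_of_le f e using 2
    ring

theorem FlDot.abs_sub_le_pow {s : ℕ} {u : ℝ} (hu : 0 ≤ u) {r : Fin s} {x y : Fin s → ℝ} {t : ℝ}
    (h : FlDot u r x y t) :
    |t - ∑ i ∈ Finset.Ici r, x i * y i| ≤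
      ((1 + u) ^ s - 1) * ∑ i ∈ Finset.Ici r, |x i * y i| := by
  obtain ⟨p, hp, ht⟩ := h
  -- At most `s` terms cost `s - 1 = l` levels of additions; the rounding of the products supplies
  -- the last factor `1 + u`.
  obtain ⟨l, rfl⟩ : ∃ l, s = l + 1 := ⟨s - 1, by have := r.2; omega⟩
  have h1 := (ht.abs_sub_sum_le hu l (by
    rw [Multiset.card_map]
    exact (Finset.card_le_univ _).trans (by simp))).1
  rw [Multiset.map_map] at h1
  change |t - ∑ i ∈ Finset.Ici r, p i| ≤
    ((1 + u) ^ l - 1) * ∑ i ∈ Finset.Ici r, |p i| at h1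
  have hpow : 1 ≤ (1 + u) ^ l := one_le_pow₀ (by linarith)
  have h2 : |∑ i ∈ Finset.Ici r, p i - ∑ i ∈ Finset.Ici r, x i * y i| ≤
      u * ∑ i ∈ Finset.Ici r, |x i * y i| := by
    rw [← Finset.sum_sub_distrib, Finset.mul_sum]
    exact (Finset.abs_sum_le_sum_abs _ _).trans
      (Finset.sum_le_sum fun i hi => (hp i (Finset.mem_Ici.1 hi)).abs_sub_le)
  have h3 : ∑ i ∈ Finset.Ici r, |p i| ≤ (1 + u) * ∑ i ∈ Finset.Ici r, |x i * y i| := by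
    rw [Finset.mul_sum]
    refine Finset.sum_le_sum fun i hi => ?_
    have := (hp i (Finset.mem_Ici.1 hi)).abs_sub_le
    have := abs_sub_abs_le_abs_sub (p i) (x i * y i)
    linarith
  have h4 := mul_le_mul_of_nonneg_left h3 (sub_nonneg.2 hpow)
  have h5 := abs_sub_le t (∑ i ∈ Finset.Ici r, p i) (∑ i ∈ Finset.Ici r, x i * y i)
  have e : ((1 + u) ^ (l + 1) - 1) * ∑ i ∈ Finset.Ici r, |x i * y i| =
      ((1 + u) ^ l - 1) * ((1 + u) * ∑ i ∈ Finset.Ici r, |x i * y i|) +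
        u * ∑ i ∈ Finset.Ici r, |x i * y i| := by ring
  rw [e]; linarith

theorem one_add_pow_sub_one_le {u : ℝ} (hu : 0 ≤ u) {s : ℕ} (h : s * u ≤ 1) :
    (1 + u) ^ s - 1 ≤ 2 * (s * u) := by
  have h0 : 0 ≤ s * u := by positivity
  have h1 : (1 + u) ^ s ≤ Real.exp (s * u) := by
    rw [Real.exp_nat_mul]
    exact pow_le_pow_left₀ (by linarith) (by linarith [Real.add_one_le_exp u]) s
  have h2 := Real.abs_exp_sub_one_le (x := s * u) (by rwa [abs_of_nonneg h0])
  rw [abs_of_nonneg h0] at h2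
  linarith [le_abs_self (Real.exp (s * u) - 1)]

theorem FlDot.abs_sub_le {s : ℕ} {u : ℝ} (hu : 0 ≤ u) (hsu : s * u ≤ 1) {r : Fin s}
    {x y : Fin s → ℝ} {t : ℝ} (h : FlDot u r x y t) :
    |t - ∑ i ∈ Finset.Ici r, x i * y i| ≤
      2 * (s * u) * ∑ i ∈ Finset.Ici r, |x i * y i| :=
  (h.abs_sub_le_pow hu).trans (mul_le_mul_of_nonneg_right (one_add_pow_sub_one_le hu hsu)
    (Finset.sum_nonneg fun _ _ => abs_nonneg _))

/-- Accuracy of the computed Householder data: `N` is the norm of the entries of `x` from `r` on,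
and `S` is the exact value of `σ`. -/
theorem FlHouseholderVector.accuracy {s : ℕ} {u : ℝ} (hu : 0 ≤ u) (hsu : s * u ≤ 1 / 1000)
    {r : Fin s} {x v : Fin s → ℝ} {b σ N S : ℝ} (h : FlHouseholderVector u r x v b σ)
    (hN : 0 < N) (hN2 : N ^ 2 = ∑ i ∈ Finset.Ici r, x i ^ 2)
    (hS : S = if 0 ≤ x r then N else -N) :
    |σ - S| ≤ 4 * (s * u) * N ∧ |v r - (x r + S)| ≤ 6 * (s * u) * |x r + S| ∧
      0 < S * (x r + S) ∧
      |b - 1 / (S * (x r + S))| ≤ 16 * (s * u) * (1 / (S * (x r + S))) := by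
  obtain ⟨⟨d, ρ, hd, hρ, hσ⟩, hv, -, w, hw, hb⟩ := h
  have hs1 : (1 : ℝ) ≤ s := by
    have := r.2
    exact_mod_cast (by omega : 1 ≤ s)
  have hug : u ≤ s * u := by nlinarith
  obtain ⟨g, hg⟩ : ∃ g, g = s * u := ⟨_, rfl⟩
  have hd' := hd.abs_sub_le hu (by linarith)
  rw [← hg] at hug hsu hd' ⊢
  have hg0 : 0 ≤ g := hu.trans hug
  -- From here on second-order terms are absorbed by rounding the coefficient of `g` up, as in 4, 6,
  -- 12, 13, 16.
  have hgg : g * g ≤ g / 1000 := by nlinarith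
  have hgu : g * u ≤ g / 1000 := by nlinarith
  have e1 : ∑ i ∈ Finset.Ici r, x i * x i = N ^ 2 := by
    rw [hN2]; exact Finset.sum_congr rfl fun i _ => (sq (x i)).symm
  have e2 : ∑ i ∈ Finset.Ici r, |x i * x i| = N ^ 2 := by
    rw [← e1]; exact Finset.sum_congr rfl fun i _ => abs_mul_self (x i)
  rw [e1, e2] at hd'
  have hd0 : 0 ≤ d := by nlinarith [abs_le.1 hd', sq_nonneg N]
  have hsq : |√d - N| ≤ 2 * g * N := by
    have h1 : |√d - N| * (√d + N) = |d - N ^ 2| := by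
      rw [← abs_of_nonneg (show 0 ≤ √d + N by positivity), ← abs_mul]
      congr 1
      have := Real.sq_sqrt hd0
      linear_combination this
    have h2 : |√d - N| * N ≤ 2 * g * N * N := by
      have : |√d - N| * N ≤ |√d - N| * (√d + N) := by
        gcongr; linarith [Real.sqrt_nonneg d]
      nlinarith
    exact le_of_mul_le_mul_right h2 hN
  have hρ' : |ρ - N| ≤ 4 * g * N := by
    refine (hρ.abs_sub_le_of_le (abs_of_pos hN).le hsq).trans ?_
    gcongr; nlinarith
  have hσ' : |σ - S| ≤ 4 * g * N := by
    rw [hσ, hS]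
    split_ifs
    · exact hρ'
    · rw [← abs_neg]; convert hρ' using 2; ring
  have hSN : |S| = N := by
    rw [hS]; split_ifs
    · exact abs_of_pos hN
    · rw [abs_neg, abs_of_pos hN]
  have hprod : S * (x r + S) = N * (N + |x r|) := by
    rw [hS]; split_ifs with h0
    · rw [abs_of_nonneg h0]; ring
    · rw [abs_of_neg (not_le.1 h0)]; ring
  -- No cancellation: `S` carries the sign of `x r`. So `|x r + S| ≥ N`, and the error of `σ`,
  -- relative to `N`, is also small relative to `x r + S`.
  have hV : |x r + S| = N + |x r| := by
    have := congrArg abs hprod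
    rw [abs_mul, hSN, abs_of_pos (by positivity : 0 < N * (N + |x r|))] at this
    exact mul_left_cancel₀ hN.ne' this
  have hNV : N ≤ |x r + S| := by rw [hV]; linarith [abs_nonneg (x r)]
  have hv' : |v r - (x r + S)| ≤ 6 * g * |x r + S| := by
    have h1 : |x r + σ - (x r + S)| ≤ 4 * g * |x r + S| := by
      rw [add_sub_add_left_eq_sub]
      exact hσ'.trans (by gcongr)
    refine (hv.abs_sub_le_of_le le_rfl h1).trans ?_
    gcongr; nlinarith
  have hpos : 0 < S * (x r + S) := by rw [hprod]; positivity
  refine ⟨hσ', hv', hpos, ?_⟩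
  have hw' : |w - S * (x r + S)| ≤ 12 * g * (S * (x r + S)) := by
    have h1 := abs_mul_sub_mul_le (a := S) (b := x r + S) hSN.le hσ' le_rfl hv'
    rw [hV, ← hprod] at h1
    have h2 := hw.abs_sub_le_of_le (abs_of_pos hpos).le h1
    refine h2.trans ?_
    gcongr; nlinarith [mul_nonneg hg0 (mul_nonneg hg0 hu)]
  generalize S * (x r + S) = q at hpos hw'
  have hwq : (1 - 12 * g) * q ≤ w := by linarith [(abs_le.1 hw').1]
  have hw0 : 0 < w := lt_of_lt_of_le (mul_pos (by linarith) hpos) hwq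
  have hinv : |1 / w - 1 / q| ≤ 13 * g * (1 / q) := by
    have e : 1 / w - 1 / q = (q - w) / (w * q) := by field_simp
    rw [e, abs_div, abs_of_pos (mul_pos hw0 hpos), div_le_iff₀ (mul_pos hw0 hpos), abs_sub_comm]
    have e' : 13 * g * (1 / q) * (w * q) = 13 * g * w := by field_simp
    rw [e']
    refine hw'.trans ?_
    have h1 : 12 * g * q ≤ 13 * g * ((1 - 12 * g) * q) := by
      nlinarith [mul_nonneg hg0 hpos.le, mul_le_mul_of_nonneg_right hgg hpos.le]
    exact h1.trans (by gcongr)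
  refine (hb.abs_sub_le_of_le (abs_of_pos (one_div_pos.2 hpos)).le hinv).trans ?_
  have := one_div_pos.2 hpos
  gcongr; nlinarith

/-! ### Euclidean norms of coordinate vectors -/

theorem norm_toLp_le_of_abs_le {s : ℕ} {a b : Fin s → ℝ} (h : ∀ i, |a i| ≤ b i) :
    ‖WithLp.toLp 2 a‖ ≤ ‖WithLp.toLp 2 b‖ := by
  rw [EuclideanSpace.norm_eq, EuclideanSpace.norm_eq]
  refine Real.sqrt_le_sqrt (Finset.sum_le_sum fun i _ => ?_)
  simp only [Real.norm_eq_abs]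
  exact pow_le_pow_left₀ (abs_nonneg _) ((h i).trans (le_abs_self _)) 2

theorem norm_toLp_le_of_abs_le_add {s : ℕ} {a x y : Fin s → ℝ} {c d : ℝ} (hc : 0 ≤ c)
    (hd : 0 ≤ d) (h : ∀ i, |a i| ≤ c * |x i| + d * |y i|) :
    ‖WithLp.toLp 2 a‖ ≤ c * ‖WithLp.toLp 2 x‖ + d * ‖WithLp.toLp 2 y‖ := by
  have h1 := norm_toLp_le_of_abs_le (b := c • (fun i => |x i|) + d • fun i => |y i|) h
  rw [WithLp.toLp_add, WithLp.toLp_smul, WithLp.toLp_smul] at h1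
  refine h1.trans ((norm_add_le _ _).trans ?_)
  rw [norm_smul, norm_smul, Real.norm_of_nonneg hc, Real.norm_of_nonneg hd]
  have e (z : Fin s → ℝ) : ‖WithLp.toLp 2 (fun i => |z i|)‖ = ‖WithLp.toLp 2 z‖ := by
    simp [EuclideanSpace.norm_eq]
  rw [e, e]

theorem sum_abs_mul_le {s : ℕ} (x y : Fin s → ℝ) :
    ∑ i, |x i * y i| ≤ ‖WithLp.toLp 2 x‖ * ‖WithLp.toLp 2 y‖ := by
  have := Real.sum_mul_le_sqrt_mul_sqrt Finset.univ (fun i => |x i|) (fun i => |y i|)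
  simpa [EuclideanSpace.norm_eq, abs_mul] using this

end SketchQR

namespace SketchQR

/-! ### One step of Householder QR -/

theorem reflection_span_singleton_orthogonal_apply {s : ℕ} (V y : Fin s → ℝ) {q : ℝ}
    (hq : ∑ i, V i ^ 2 = 2 * q) (i : Fin s) :
    ((ℝ ∙ WithLp.toLp 2 V)ᗮ.reflection (WithLp.toLp 2 y)) i =
      y i - 1 / q * (∑ j, V j * y j) * V i := by
  rw [Submodule.reflection_orthogonal_apply, Submodule.reflection_singleton_apply]
  have h1 : ‖WithLp.toLp 2 V‖ ^ 2 = 2 * q := by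
    rw [EuclideanSpace.norm_sq_eq, ← hq]; simp
  have h2 : inner ℝ (WithLp.toLp 2 V) (WithLp.toLp 2 y) = ∑ j, V j * y j := by
    simp [PiLp.inner_apply, mul_comm]
  simp only [RCLike.ofReal_real_eq_id, id_eq, h1, h2, PiLp.neg_apply, PiLp.sub_apply,
    PiLp.smul_apply, smul_eq_mul, nsmul_eq_mul]
  rcases eq_or_ne q 0 with rfl | h0
  · simp
  · push_cast; field_simp; ring

theorem sum_Ici_eq_sum_Ioi_add {s : ℕ} (r : Fin s) (f : Fin s → ℝ) :
    ∑ i ∈ Finset.Ici r, f i = f r + ∑ i ∈ Finset.Ioi r, f i := by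
  rw [← Finset.Ioi_insert, Finset.sum_insert (by simp)]

theorem sum_eq_sum_Ici {s : ℕ} (r : Fin s) {f : Fin s → ℝ} (h : ∀ i, i < r → f i = 0) :
    ∑ i, f i = ∑ i ∈ Finset.Ici r, f i :=
  (Finset.sum_subset (Finset.subset_univ _) fun i _ hi =>
    h i (by simpa using hi)).symm

/-- Error of a computed reflector application, where `V` and `1 / q` are the exact data. -/
theorem FlApplyReflector.abs_sub_le {s : ℕ} {u : ℝ} (hu : 0 ≤ u) (hsu : s * u ≤ 1 / 1000)
    {r : Fin s} {v V y y' : Fin s → ℝ} {b q : ℝ} (h : FlApplyReflector u r v b y y')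
    (hq : 0 < q) (hV : ∀ i, i < r → V i = 0)
    (hv : ∀ i, r ≤ i → |v i - V i| ≤ 6 * (s * u) * |V i|)
    (hb : |b - 1 / q| ≤ 16 * (s * u) * (1 / q)) (i : Fin s) :
    |y' i - (y i - 1 / q * (∑ j, V j * y j) * V i)| ≤ (s * u) * |y i| +
      121 * (s * u) * (1 / q * (‖WithLp.toLp 2 V‖ * ‖WithLp.toLp 2 y‖)) * |V i| := by
  obtain ⟨t, τ, ht, hτ, hlow, hup⟩ := h
  have hs1 : (1 : ℝ) ≤ s := by
    have := r.2
    exact_mod_cast (by omega : 1 ≤ s)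
  have hug : u ≤ s * u := by nlinarith
  obtain ⟨g, hg⟩ : ∃ g, g = s * u := ⟨_, rfl⟩
  have ht' := ht.abs_sub_le hu (by linarith)
  rw [← hg] at hug hsu ht' hv hb ⊢
  have hg0 : 0 ≤ g := hu.trans hug
  have hgg : g * g ≤ g / 1000 := by nlinarith
  have hgu : g * u ≤ g / 1000 := by nlinarith
  have hq' : 0 < 1 / q := one_div_pos.2 hq
  -- The inner product may cancel, so its error is measured against this Cauchy–Schwarz bound and
  -- not against its value.
  set D := ‖WithLp.toLp 2 V‖ * ‖WithLp.toLp 2 y‖ with hD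
  have hD0 : 0 ≤ D := by positivity
  rcases lt_or_ge i r with hir | hir
  · rw [hlow i hir, hV i hir]
    simpa using mul_nonneg hg0 (abs_nonneg (y i))
  have hDs : ∑ j ∈ Finset.Ici r, |V j * y j| ≤ D :=
    (Finset.sum_le_sum_of_subset_of_nonneg (Finset.subset_univ _)
      fun _ _ _ => abs_nonneg _).trans (sum_abs_mul_le V y)
  have hsum : ∑ j, V j * y j = ∑ j ∈ Finset.Ici r, V j * y j :=
    sum_eq_sum_Ici r fun j hj => by rw [hV j hj, zero_mul]
  have hT : |∑ j, V j * y j| ≤ D := by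
    rw [hsum]; exact (Finset.abs_sum_le_sum_abs _ _).trans hDs
  have h1 : |∑ j ∈ Finset.Ici r, v j * y j - ∑ j, V j * y j| ≤ 6 * g * D := by
    rw [hsum, ← Finset.sum_sub_distrib]
    refine (Finset.abs_sum_le_sum_abs _ _).trans ((Finset.sum_le_sum fun j hj => ?_).trans
      (?_ : ∑ j ∈ Finset.Ici r, 6 * g * |V j * y j| ≤ _))
    · rw [← sub_mul, abs_mul, abs_mul, ← mul_assoc]
      exact mul_le_mul_of_nonneg_right (hv j (Finset.mem_Ici.1 hj)) (abs_nonneg _)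
    · rw [← Finset.mul_sum]; gcongr
  have h2 : ∑ j ∈ Finset.Ici r, |v j * y j| ≤ (1 + 6 * g) * D := by
    refine (Finset.sum_le_sum fun j hj => ?_).trans
      ((?_ : ∑ j ∈ Finset.Ici r, (1 + 6 * g) * |V j * y j| ≤ _))
    · rw [abs_mul, abs_mul, ← mul_assoc]
      have := hv j (Finset.mem_Ici.1 hj)
      have := abs_sub_abs_le_abs_sub (v j) (V j)
      gcongr; linarith
    · rw [← Finset.mul_sum]; gcongr
  obtain ⟨T, hTd⟩ : ∃ T, T = ∑ j, V j * y j := ⟨_, rfl⟩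
  rw [← hTd] at hT h1 ⊢
  have ht2 : |t - T| ≤ 9 * g * D := by
    refine (_root_.abs_sub_le t _ T).trans ((add_le_add ht' h1).trans ?_)
    have := mul_le_mul_of_nonneg_left h2 (show 0 ≤ 2 * g by positivity)
    nlinarith [mul_le_mul_of_nonneg_right hgg hD0]
  have hτ' : |τ - 1 / q * T| ≤ 28 * g * (1 / q * D) := by
    have := abs_mul_sub_mul_le (abs_of_pos hq').le hb hT ht2
    have hc : |1 / q * T| ≤ 1 / q * D := by
      rw [abs_mul, abs_of_pos hq']; gcongr
    refine (hτ.abs_sub_le_of_le hc this).trans ?_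
    gcongr
    nlinarith [mul_nonneg hg0 (mul_nonneg hg0 hu)]
  have hc : |1 / q * T| ≤ 1 / q * D := by
    rw [abs_mul, abs_of_pos hq']; gcongr
  obtain ⟨p, hp, hy⟩ := hup i hir
  have hp' : |p - 1 / q * T * V i| ≤ 40 * g * (1 / q * D * |V i|) := by
    have h3 := abs_mul_sub_mul_le hc hτ' le_rfl (hv i hir)
    have h4 : |1 / q * T * V i| ≤ 1 / q * D * |V i| := by
      rw [abs_mul]; gcongr
    refine (hp.abs_sub_le_of_le h4 h3).trans ?_
    gcongr
    nlinarith [mul_nonneg hg0 (mul_nonneg hg0 hu)]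
  have hy' := hy.abs_sub_le
  have hC : 0 ≤ 1 / q * D * |V i| := by positivity
  have h4 : |1 / q * T * V i| ≤ 1 / q * D * |V i| := by
    rw [abs_mul]; gcongr
  have h5 : |y i - p| ≤ |y i| + (1 + 40 * g) * (1 / q * D * |V i|) := by
    have := abs_sub (y i) p
    have := abs_sub_abs_le_abs_sub p (1 / q * T * V i)
    linarith
  have h6 : u * |y i - p| ≤ g * |y i| + g * ((1 + 40 * g) * (1 / q * D * |V i|)) := by
    rw [← mul_add]; gcongr
  have e : y' i - (y i - 1 / q * T * V i) = (y' i - (y i - p)) - (p - 1 / q * T * V i) := by ring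
  rw [e]
  refine (abs_sub _ _).trans ?_
  have e2 : 121 * g * (1 / q * D) * |V i| = 121 * g * (1 / q * D * |V i|) := by ring
  rw [e2]
  nlinarith [mul_le_mul_of_nonneg_right hgg hC, mul_nonneg hg0 hC]

/-- The columns to the left of the pivot have no entries in the rows that a step changes. -/
theorem HouseholderStep.exists_isometry {s n : ℕ} {u : ℝ} (hu : 0 ≤ u)
    (hsu : s * u ≤ 1 / 1000) {r : Fin s} {k : Fin n} {Z Z' : Matrix (Fin s) (Fin n) ℝ}
    (h : HouseholderStep u r k Z Z') (hZ : ∀ j, j < k → ∀ i, r ≤ i → Z i j = 0) :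
    ∃ P : EuclideanSpace ℝ (Fin s) →ₗᵢ[ℝ] EuclideanSpace ℝ (Fin s), ∀ j,
      ‖WithLp.toLp 2 (Z'.col j) - P (WithLp.toLp 2 (Z.col j))‖ ≤
        250 * (s * u) * ‖WithLp.toLp 2 (Z.col j)‖ := by
  have hg0 : 0 ≤ s * u := by positivity
  have hg (c : ℝ) (y : Fin s → ℝ) (hc : 0 ≤ c) : 0 ≤ c * (s * u) * ‖WithLp.toLp 2 y‖ := by
    positivity
  rcases h with ⟨-, rfl⟩ | ⟨⟨i₀, hi₀, hne⟩, v, b, σ, hvec, hleft, htop, hpiv, hzero, happ⟩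
  · exact ⟨.id, fun j => by simpa using hg 250 _ (by norm_num)⟩
  set x : Fin s → ℝ := fun i => Z i k with hx
  set N := √(∑ i ∈ Finset.Ici r, x i ^ 2) with hNdef
  have hsum : 0 < ∑ i ∈ Finset.Ici r, x i ^ 2 :=
    Finset.sum_pos' (fun _ _ => sq_nonneg _) ⟨i₀, Finset.mem_Ici.2 hi₀, by positivity⟩
  have hN : 0 < N := Real.sqrt_pos.2 hsum
  have hN2 : N ^ 2 = ∑ i ∈ Finset.Ici r, x i ^ 2 := Real.sq_sqrt hsum.le
  obtain ⟨S, hS⟩ : ∃ S, S = if 0 ≤ x r then N else -N := ⟨_, rfl⟩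
  have hS2 : S ^ 2 = N ^ 2 := by rw [hS]; split_ifs <;> ring
  obtain ⟨hσ, hvr, hq, hb⟩ := hvec.accuracy hu hsu hN hN2 hS
  set q := S * (x r + S) with hqdef
  set V : Fin s → ℝ := fun i => if i < r then 0 else if i = r then x r + S else x i with hVdef
  have hVlt : ∀ i, i < r → V i = 0 := fun i hi => by simp [hVdef, hi]
  have hVr : V r = x r + S := by simp [hVdef]
  have hVgt : ∀ i, r < i → V i = x i := fun i hi => by simp [hVdef, hi.not_gt, hi.ne']
  -- Since `S² = N²`, both `‖V‖² = 2q` and `Vᵀx = q` hold: the first makes `I - V Vᵀ / q` a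
  -- reflection, the second makes it send `x` to `x - V`, that is, to `-S e_r` on the rows from `r`
  -- on.
  rw [sum_Ici_eq_sum_Ioi_add] at hN2
  have hVV : ∑ i, V i ^ 2 = 2 * q := by
    rw [sum_eq_sum_Ici r fun i hi => by rw [hVlt i hi]; ring, sum_Ici_eq_sum_Ioi_add, hVr,
      Finset.sum_congr rfl fun i hi => by rw [hVgt i (Finset.mem_Ioi.1 hi)]]
    linear_combination -hS2 - hN2
  have hVx : ∑ i, V i * x i = q := by
    rw [sum_eq_sum_Ici r fun i hi => by rw [hVlt i hi]; ring, sum_Ici_eq_sum_Ioi_add, hVr,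
      Finset.sum_congr rfl fun i hi => by rw [hVgt i (Finset.mem_Ioi.1 hi), ← sq]]
    linear_combination -hS2 - hN2
  refine ⟨((ℝ ∙ WithLp.toLp 2 V)ᗮ.reflection).toLinearIsometry, fun j => ?_⟩
  obtain ⟨e, he⟩ : ∃ e : Fin s → ℝ, e = fun i => Z' i j -
      (Z i j - 1 / q * (∑ l, V l * Z l j) * V i) := ⟨_, rfl⟩
  have hnorm : WithLp.toLp 2 (Z'.col j) -
      ((ℝ ∙ WithLp.toLp 2 V)ᗮ.reflection).toLinearIsometry (WithLp.toLp 2 (Z.col j)) =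
        WithLp.toLp 2 e := by
    ext i
    rw [he]
    simp only [LinearIsometryEquiv.coe_toLinearIsometry, PiLp.sub_apply,
      reflection_span_singleton_orthogonal_apply V _ hVV]
    rfl
  rw [hnorm]
  rcases lt_trichotomy j k with hj | rfl | hj
  -- Columns to the left are orthogonal to `V`, so the reflection fixes them and leaving them
  -- untouched is exact.
  · have hz : ∑ l, V l * Z l j = 0 := Finset.sum_eq_zero fun l _ => by
      rcases lt_or_ge l r with hl | hl
      · rw [hVlt l hl, zero_mul]
      · rw [hZ j hj l hl, mul_zero]
    have he0 : e = 0 := by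
      rw [he]; funext i; rw [hz, hleft j hj]; simp
    rw [he0]
    simpa using hg 250 _ (by norm_num)
  -- In the pivot column the only error is `σ - S`, in row `r`.
  · have hq1 : 1 / q * q = 1 := one_div_mul_cancel hq.ne'
    have hNx : N ≤ ‖WithLp.toLp 2 (Z.col j)‖ := by
      rw [EuclideanSpace.norm_eq, hNdef]
      refine Real.sqrt_le_sqrt ?_
      simp only [Real.norm_eq_abs, sq_abs]
      exact Finset.sum_le_sum_of_subset_of_nonneg (Finset.subset_univ _)
        fun _ _ _ => sq_nonneg _
    have hle : ∀ i, |e i| ≤ 0 * |(0 : Fin s → ℝ) i| +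
        (4 * (s * u) * N) * |(Pi.single r 1 : Fin s → ℝ) i| := by
      intro i
      have hVx' : ∑ l, V l * Z l j = q := hVx
      rw [he]
      simp only [hVx', hq1, one_mul]
      rcases lt_trichotomy i r with hi | rfl | hi
      · rw [htop i hi, hVlt i hi]; simp [hi.ne]
      · rw [hpiv, hVr]
        simp only [hx, Pi.single_eq_same, abs_one, mul_one]
        rw [zero_mul, zero_add, ← abs_neg]
        convert hσ using 2; ring
      · rw [hzero i hi, hVgt i hi]; simp [hx, hi.ne']
    have h1 := norm_toLp_le_of_abs_le_add le_rfl (by positivity) hle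
    have h2 : ‖WithLp.toLp 2 (Pi.single r 1 : Fin s → ℝ)‖ = 1 := by simp
    rw [h2, zero_mul, zero_add, mul_one] at h1
    refine h1.trans ?_
    gcongr
    norm_num
  · have hv' : ∀ i, r ≤ i → |v i - V i| ≤ 6 * (s * u) * |V i| := by
      intro i hi
      rcases hi.eq_or_lt with rfl | hi
      · rw [hVr]; exact hvr
      · rw [hvec.2.2.1 i hi, hVgt i hi, sub_self, abs_zero]
        positivity
    have hle := fun i => (happ j hj).abs_sub_le hu hsu hq hVlt hv' hb i
    have h1 := norm_toLp_le_of_abs_le_add (a := e) (x := Z.col j) (y := V)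
      (d := 121 * (s * u) * (1 / q * (‖WithLp.toLp 2 V‖ * ‖WithLp.toLp 2 (Z.col j)‖)))
      hg0 (by positivity) (by intro i; rw [he]; exact hle i)
    have hVn : ‖WithLp.toLp 2 V‖ ^ 2 = 2 * q := by
      rw [EuclideanSpace.norm_sq_eq, ← hVV]; simp
    -- The scaling of `V` drops out, and the total is `1 + 2 · 121 = 243 ≤ 250`.
    have hVq : 1 / q * ‖WithLp.toLp 2 V‖ ^ 2 = 2 := by rw [hVn]; field_simp
    refine h1.trans ?_
    have e2 : 121 * (s * u) * (1 / q * (‖WithLp.toLp 2 V‖ * ‖WithLp.toLp 2 (Z.col j)‖)) *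
        ‖WithLp.toLp 2 V‖ = 121 * (s * u) * (1 / q * ‖WithLp.toLp 2 V‖ ^ 2) *
          ‖WithLp.toLp 2 (Z.col j)‖ := by ring
    rw [e2, hVq]
    nlinarith [mul_nonneg hg0 (norm_nonneg (WithLp.toLp 2 (Z.col j)))]

end SketchQR

namespace SketchQR

/-! ### Spectral norms and pseudoinverses -/

theorem norm_toLp_mulVec_le {p q : ℕ} (M : Matrix (Fin p) (Fin q) ℝ) (w : Fin q → ℝ) :
    ‖WithLp.toLp 2 (M *ᵥ w)‖ ≤ ‖M‖ * ‖WithLp.toLp 2 w‖ :=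
  Matrix.l2_opNorm_mulVec M (WithLp.toLp 2 w)

theorem norm_le_of_norm_toLp_mulVec_le {p q : ℕ} {M : Matrix (Fin p) (Fin q) ℝ} {C : ℝ}
    (hC : 0 ≤ C) (h : ∀ w, ‖WithLp.toLp 2 (M *ᵥ w)‖ ≤ C * ‖WithLp.toLp 2 w‖) : ‖M‖ ≤ C := by
  rw [Matrix.l2_opNorm_def]
  exact ContinuousLinearMap.opNorm_le_bound _ hC fun w => h w.ofLp

theorem norm_toLp_sq {p : ℕ} (w : Fin p → ℝ) : ‖WithLp.toLp 2 w‖ ^ 2 = w ⬝ᵥ w := by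
  rw [EuclideanSpace.norm_sq_eq]
  simp [dotProduct, sq]

theorem norm_toLp_mulVec_of_orthonormal {p q : ℕ} {Q : Matrix (Fin p) (Fin q) ℝ}
    (hQ : Qᵀ * Q = 1) (w : Fin q → ℝ) : ‖WithLp.toLp 2 (Q *ᵥ w)‖ = ‖WithLp.toLp 2 w‖ := by
  have h : ‖WithLp.toLp 2 (Q *ᵥ w)‖ ^ 2 = ‖WithLp.toLp 2 w‖ ^ 2 := by
    rw [norm_toLp_sq, norm_toLp_sq, Matrix.dotProduct_mulVec, Matrix.vecMul_mulVec, hQ,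
      Matrix.vecMul_one]
  exact (pow_left_inj₀ (norm_nonneg _) (norm_nonneg _) two_ne_zero).1 h

theorem mulVec_injective_of_rank_eq {p q : ℕ} {M : Matrix (Fin p) (Fin q) ℝ}
    (h : M.rank = q) : Function.Injective M.mulVec := by
  have h1 := LinearMap.finrank_range_add_finrank_ker M.mulVecLin
  rw [Matrix.rank] at h
  rw [h, Module.finrank_fin_fun] at h1
  have h2 : LinearMap.ker M.mulVecLin = ⊥ := Submodule.finrank_eq_zero.1 (by omega)
  exact LinearMap.ker_eq_bot.1 h2

theorem mulVec_injective_of_norm_le {p q : ℕ} {M : Matrix (Fin p) (Fin q) ℝ} {C : ℝ}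
    (h : ∀ w, ‖WithLp.toLp 2 w‖ ≤ C * ‖WithLp.toLp 2 (M *ᵥ w)‖) :
    Function.Injective M.mulVec := by
  refine (injective_iff_map_eq_zero M.mulVecLin).2 fun w hw => ?_
  have h1 := h w
  rw [show M *ᵥ w = 0 from hw, WithLp.toLp_zero, norm_zero, mul_zero, norm_le_zero_iff] at h1
  simpa using h1

theorem pinv_mul_self {p q : ℕ} {M : Matrix (Fin p) (Fin q) ℝ}
    (h : Function.Injective M.mulVec) : pinv M * M = 1 := by
  refine Matrix.ext_of_mulVec_single fun i => h ?_
  rw [Matrix.mulVec_mulVec, ← Matrix.mul_assoc, (pinv_spec M).mul_mul_self, Matrix.one_mulVec]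

/-- Together with `norm_pinv_le` this identifies `‖pinv M‖` as the least constant in such an
inequality, which turns statements about pseudoinverses into statements about `‖M w‖`. -/
theorem norm_le_norm_pinv_mul {p q : ℕ} {M : Matrix (Fin p) (Fin q) ℝ}
    (h : Function.Injective M.mulVec) (w : Fin q → ℝ) :
    ‖WithLp.toLp 2 w‖ ≤ ‖pinv M‖ * ‖WithLp.toLp 2 (M *ᵥ w)‖ := by
  have h1 := norm_toLp_mulVec_le (pinv M) (M *ᵥ w)
  rwa [Matrix.mulVec_mulVec, pinv_mul_self h, Matrix.one_mulVec] at h1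

/-- `P = M * pinv M` is a symmetric idempotent, so `‖P‖² = ‖Pᵀ P‖ = ‖P‖`. -/
theorem norm_mul_pinv_le_one {p q : ℕ} (M : Matrix (Fin p) (Fin q) ℝ) : ‖M * pinv M‖ ≤ 1 := by
  have h := Matrix.l2_opNorm_conjTranspose_mul_self (M * pinv M)
  rw [Matrix.conjTranspose_eq_transpose_of_trivial, (pinv_spec M).symm_left, ← Matrix.mul_assoc,
    (pinv_spec M).mul_mul_self] at h
  nlinarith [norm_nonneg (M * pinv M)]

theorem norm_pinv_le {p q : ℕ} {M : Matrix (Fin p) (Fin q) ℝ} {C : ℝ} (hC : 0 ≤ C)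
    (h : ∀ w, ‖WithLp.toLp 2 w‖ ≤ C * ‖WithLp.toLp 2 (M *ᵥ w)‖) : ‖pinv M‖ ≤ C := by
  refine norm_le_of_norm_toLp_mulVec_le hC fun z => (h _).trans ?_
  rw [Matrix.mulVec_mulVec]
  gcongr
  refine (norm_toLp_mulVec_le _ z).trans ?_
  exact mul_le_of_le_one_left (norm_nonneg _) (norm_mul_pinv_le_one M)

/-! ### Backward error of Householder QR -/

theorem toLp_mulVec_eq_sum {p q : ℕ} (M : Matrix (Fin p) (Fin q) ℝ) (w : Fin q → ℝ) :
    WithLp.toLp 2 (M *ᵥ w) = ∑ j, w j • WithLp.toLp 2 (M.col j) := by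
  ext i
  simp [Matrix.mulVec, dotProduct, mul_comm]

theorem norm_col_le {p q : ℕ} (M : Matrix (Fin p) (Fin q) ℝ) (j : Fin q) :
    ‖WithLp.toLp 2 (M.col j)‖ ≤ ‖M‖ := by
  simpa using norm_toLp_mulVec_le M (Pi.single j 1)

theorem sum_abs_le_sqrt_mul_norm {q : ℕ} (w : Fin q → ℝ) :
    ∑ j, |w j| ≤ √q * ‖WithLp.toLp 2 w‖ := by
  simpa [EuclideanSpace.norm_eq] using sum_abs_mul_le (fun _ => (1 : ℝ)) w

theorem HouseholderStep.zero_below {s n : ℕ} {u : ℝ} {r : Fin s} {k : Fin n}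
    {Z Z' : Matrix (Fin s) (Fin n) ℝ} (h : HouseholderStep u r k Z Z') :
    (∀ j, j < k → ∀ i, Z' i j = Z i j) ∧ ∀ i, r < i → Z' i k = 0 := by
  rcases h with ⟨h, rfl⟩ | ⟨-, v, b, σ, -, hleft, -, -, hzero, -⟩
  · exact ⟨fun _ _ _ => rfl, h⟩
  · exact ⟨hleft, hzero⟩

theorem zero_below_of_householderSteps {s n : ℕ} {hns : n ≤ s} {u : ℝ}
    {Z : ℕ → Matrix (Fin s) (Fin n) ℝ}
    (h : ∀ k : Fin n, HouseholderStep u (Fin.castLE hns k) k (Z k) (Z (k + 1))) (k : ℕ)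
    (hk : k ≤ n) : ∀ j : Fin n, (j : ℕ) < k → ∀ i : Fin s, (j : ℕ) < i → Z k i j = 0 := by
  induction k with
  | zero => intro j hj; omega
  | succ k ih =>
    intro j hj i hi
    obtain ⟨h1, h2⟩ := (h ⟨k, hk⟩).zero_below
    rcases Nat.lt_succ_iff_lt_or_eq.1 hj with hjk | hjk
    · exact (h1 j (by simpa [Fin.lt_def] using hjk) i).trans (ih (by omega) j hjk i hi)
    · obtain rfl : j = ⟨k, hk⟩ := Fin.ext hjk
      exact h2 i (by simpa [Fin.lt_def] using hi)

/-- Only norms are compared, so the product of the reflectors never has to be formed: each isometry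
disappears on taking norms and its step contributes only its error. That error is relative to the
current columns, whence the simultaneous bound on their growth; `√n` comes from `∑ |w j| ≤ √n ‖w‖`.
-/
theorem abs_norm_sub_norm_le_of_householderSteps {s n : ℕ} {hns : n ≤ s} {u : ℝ} (hu : 0 ≤ u)
    (hsu : s * u ≤ 1 / 1000) {Z : ℕ → Matrix (Fin s) (Fin n) ℝ}
    (h : ∀ k : Fin n, HouseholderStep u (Fin.castLE hns k) k (Z k) (Z (k + 1))) (k : ℕ)
    (hk : k ≤ n) :
    (∀ j, ‖WithLp.toLp 2 ((Z k).col j)‖ ≤ (1 + 250 * (s * u)) ^ k * ‖Z 0‖) ∧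
      ∀ w, |‖WithLp.toLp 2 (Z k *ᵥ w)‖ - ‖WithLp.toLp 2 (Z 0 *ᵥ w)‖| ≤
        ((1 + 250 * (s * u)) ^ k - 1) * (√n * ‖Z 0‖ * ‖WithLp.toLp 2 w‖) := by
  obtain ⟨η, hη⟩ : ∃ η, η = 250 * (s * u) := ⟨_, rfl⟩
  have hη0 : 0 ≤ η := by rw [hη]; positivity
  rw [← hη]
  induction k with
  | zero => exact ⟨fun j => by simpa using norm_col_le (Z 0) j, fun w => by simp⟩
  | succ k ih =>
    obtain ⟨ih1, ih2⟩ := ih (by omega)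
    obtain ⟨P, hP⟩ := (h ⟨k, hk⟩).exists_isometry hu hsu fun j hj i hi =>
      zero_below_of_householderSteps h k (by omega) j (by simpa [Fin.lt_def] using hj) i
        (lt_of_lt_of_le (by simpa [Fin.lt_def] using hj) (Fin.le_def.1 hi))
    rw [← hη] at hP
    change ∀ j, ‖WithLp.toLp 2 ((Z (k + 1)).col j) - P (WithLp.toLp 2 ((Z k).col j))‖ ≤
      η * ‖WithLp.toLp 2 ((Z k).col j)‖ at hP
    refine ⟨fun j => ?_, fun w => ?_⟩
    · have h1 := norm_le_norm_add_norm_sub' (WithLp.toLp 2 ((Z (k + 1)).col j))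
        (P (WithLp.toLp 2 ((Z k).col j)))
      rw [P.norm_map] at h1
      have h2 := mul_le_mul_of_nonneg_left (ih1 j) (show 0 ≤ 1 + η by linarith)
      have := hP j
      rw [pow_succ]
      linarith
    · have e : WithLp.toLp 2 (Z (k + 1) *ᵥ w) - P (WithLp.toLp 2 (Z k *ᵥ w)) =
          ∑ j, w j • (WithLp.toLp 2 ((Z (k + 1)).col j) - P (WithLp.toLp 2 ((Z k).col j))) := by
        simp only [toLp_mulVec_eq_sum, map_sum, map_smul, smul_sub, Finset.sum_sub_distrib]
      have h1 : ‖WithLp.toLp 2 (Z (k + 1) *ᵥ w) - P (WithLp.toLp 2 (Z k *ᵥ w))‖ ≤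
          (η * ((1 + η) ^ k * ‖Z 0‖)) * (√n * ‖WithLp.toLp 2 w‖) := by
        rw [e]
        refine (norm_sum_le _ _).trans ((Finset.sum_le_sum fun j _ =>
          (?_ : _ ≤ (η * ((1 + η) ^ k * ‖Z 0‖)) * |w j|)).trans ?_)
        · rw [norm_smul, Real.norm_eq_abs, mul_comm]
          gcongr
          exact (hP j).trans (mul_le_mul_of_nonneg_left (ih1 j) hη0)
        · rw [← Finset.mul_sum]
          gcongr
          exact sum_abs_le_sqrt_mul_norm w
      have h2 := abs_norm_sub_norm_le (WithLp.toLp 2 (Z (k + 1) *ᵥ w))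
        (P (WithLp.toLp 2 (Z k *ᵥ w)))
      rw [P.norm_map] at h2
      refine (abs_sub_le _ ‖WithLp.toLp 2 (Z k *ᵥ w)‖ _).trans
        ((add_le_add (h2.trans h1) (ih2 w)).trans_eq ?_)
      ring

/-- The computed `R`-factor is as good as that of an orthogonal factorization of a matrix near
`Y`. -/
theorem IsComputedRFactor.abs_norm_sub_norm_le {s n : ℕ} {hns : n ≤ s} {u : ℝ} (hu : 0 ≤ u)
    (hn : 0 < n) (hsu : s * n * u ≤ 1 / 1000) {Y : Matrix (Fin s) (Fin n) ℝ}
    {Rh : Matrix (Fin n) (Fin n) ℝ} (h : IsComputedRFactor hns u Y Rh) (w : Fin n → ℝ) :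
    |‖WithLp.toLp 2 (Rh *ᵥ w)‖ - ‖WithLp.toLp 2 (Y *ᵥ w)‖| ≤
      500 * (s * n * u) * (√n * ‖Y‖ * ‖WithLp.toLp 2 w‖) := by
  obtain ⟨Z, rfl, hstep, rfl⟩ := h
  have hn1 : (1 : ℝ) ≤ n := by exact_mod_cast hn
  have h0 : 0 ≤ s * u := by positivity
  have h1 : (s : ℝ) * u ≤ 1 / 1000 := by nlinarith
  have h2 := (abs_norm_sub_norm_le_of_householderSteps hu h1 hstep n le_rfl).2 w
  -- After the last step the rows below the leading block are zero, so dropping them does not change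
  -- the norm.
  have h3 : ‖WithLp.toLp 2 ((Z n).submatrix (Fin.castLE hns) id *ᵥ w)‖ =
      ‖WithLp.toLp 2 (Z n *ᵥ w)‖ := by
    rw [EuclideanSpace.norm_eq, EuclideanSpace.norm_eq]
    congr 1
    refine Finset.sum_of_injOn (Fin.castLE hns) (Fin.castLE_injective hns).injOn (by simp) ?_
      fun i _ => rfl
    intro i _ hi
    have hni : n ≤ i := by
      by_contra hlt
      exact hi ⟨⟨i, not_le.1 hlt⟩, by simp, rfl⟩
    have : (Z n *ᵥ w) i = 0 := by
      rw [Matrix.mulVec_eq_sum, Finset.sum_apply]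
      refine Finset.sum_eq_zero fun j _ => ?_
      change Z n i j * w j = 0
      rw [zero_below_of_householderSteps hstep n le_rfl j j.2 i (by omega), zero_mul]
    simp [this]
  rw [h3]
  refine h2.trans ?_
  gcongr
  have h4 : (n : ℝ) * (250 * (s * u)) ≤ 1 := by linarith
  linarith [one_add_pow_sub_one_le (u := 250 * (s * u)) (by positivity) h4]

/-! ### Condition of the computed factor -/

theorem four_mul_sqrt_le_logFactor {n : ℕ} (hn : 0 < n) : 4 * √n ≤ logFactor n := by
  have : 0 ≤ Real.logb 2 n := Real.logb_nonneg one_lt_two (by exact_mod_cast hn)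
  unfold logFactor
  gcongr; linarith

/-- Two successive relative errors, `x` from `a` to `b` and `y` from `b` to `c`, both small enough
that `1 / (1 - ε) ≤ 1 + 2ε`. The constants in the conclusion leave ample room. -/
theorem bounds_of_relative_errors {a b c x y X G : ℝ} (hx : 0 ≤ x) (hy : 0 ≤ y) (hX : 4 * x ≤ X)
    (hX1 : X < 1) (hy8 : y ≤ 1 / 8) (hG : y ≤ 5 / 24 * G) (ha : 0 ≤ a) (hb : 0 ≤ b)
    (hab : |b - a| ≤ x * a) (hbc : |c - b| ≤ y * b) :
    c ≤ (1 + 18 * G) * (1 + 2 * X) * a ∧ a ≤ (1 + 18 * G) * (1 + 2 * X) * c := by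
  obtain ⟨a1, a2⟩ := abs_le.1 hab
  obtain ⟨b1, b2⟩ := abs_le.1 hbc
  have hG0 : 0 ≤ G := by linarith
  have hX0 : 0 ≤ X := by linarith
  have lower {p q ε : ℝ} (hε : 0 ≤ ε) (hε2 : ε ≤ 1 / 2) (hp : 0 ≤ p) (h : (1 - ε) * p ≤ q) :
      p ≤ (1 + 2 * ε) * q := by
    have h1 := mul_le_mul_of_nonneg_left h (show 0 ≤ 1 + 2 * ε by linarith)
    have h2 : 0 ≤ ε * (1 - 2 * ε) * p :=
      mul_nonneg (mul_nonneg hε (by linarith)) hp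
    linarith
  have hc : 0 ≤ c := (mul_nonneg (by linarith : 0 ≤ 1 - y) hb).trans (by linarith)
  constructor
  · calc c ≤ (1 + y) * b := by linarith
      _ ≤ (1 + 18 * G) * ((1 + x) * a) :=
        mul_le_mul (by linarith) (by linarith) hb (by linarith)
      _ ≤ (1 + 18 * G) * ((1 + 2 * X) * a) := by gcongr; linarith
      _ = _ := by ring
  · calc a ≤ (1 + 2 * x) * b := lower hx (by linarith) ha (by linarith)
      _ ≤ (1 + 2 * X) * ((1 + 2 * y) * c) :=
        mul_le_mul (by linarith) (lower hy (by linarith) hb (by linarith)) hb (by linarith)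
      _ ≤ (1 + 2 * X) * ((1 + 18 * G) * c) := by gcongr <;> linarith
      _ = _ := by ring

/-- Comparison of the sketch with the computed `R`-factor of the computed sketch. -/
theorem norm_comparison {s n : ℕ} {hns : n ≤ s} {u : ℝ} (hu : 0 ≤ u)
    {Y Δ : Matrix (Fin s) (Fin n) ℝ} {Rh : Matrix (Fin n) (Fin n) ℝ}
    (hY : Function.Injective Y.mulVec) (hR : IsComputedRFactor hns u (Y + Δ) Rh)
    (hsu : 1000 * (s * n : ℕ) * u < 1)
    (hQR : logFactor n * gammaTilde 1000 (s * n) u * cond2 (Y + Δ) < 1)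
    (hΔ : logFactor n * ‖pinv Y‖ * ‖Δ‖ < 1) :
    1 ≤ amplification 1000 u Y Δ ∧ ∀ z,
      ‖WithLp.toLp 2 (Rh *ᵥ z)‖ ≤ amplification 1000 u Y Δ * ‖WithLp.toLp 2 (Y *ᵥ z)‖ ∧
      ‖WithLp.toLp 2 (Y *ᵥ z)‖ ≤ amplification 1000 u Y Δ * ‖WithLp.toLp 2 (Rh *ᵥ z)‖ := by
  -- For `n = 0` the factor `logFactor n` vanishes because `√0 = 0`, so the amplification is 1 and
  -- all vectors are zero.
  rcases Nat.eq_zero_or_pos n with rfl | hn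
  · refine ⟨by simp [amplification, logFactor], fun z => ?_⟩
    rw [Subsingleton.elim z 0]
    simp only [Matrix.mulVec_zero, WithLp.toLp_zero, norm_zero, mul_zero, le_refl, and_self]
  have hL := four_mul_sqrt_le_logFactor hn
  have hsq : 1 ≤ √(n : ℝ) := Real.one_le_sqrt.2 (by exact_mod_cast hn)
  have hgam : 1000 * (s * n * u) ≤ gammaTilde 1000 (s * n) u := by
    unfold gammaTilde
    have h0 : 0 ≤ 1000 * ((s * n : ℕ) : ℝ) * u := by positivity
    have h1 : 0 < 1 - 1000 * ((s * n : ℕ) : ℝ) * u := by linarith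
    rw [le_div_iff₀ h1]
    push_cast at h0 ⊢
    nlinarith
  have hback := hR.abs_norm_sub_norm_le hu hn (by push_cast at hsu; linarith)
  obtain ⟨τ, hτ⟩ : ∃ τ, τ = s * n * u := ⟨_, rfl⟩
  have hτ0 : 0 ≤ τ := by rw [hτ]; positivity
  simp only [← hτ] at hgam hback
  unfold amplification
  unfold cond2 at hQR ⊢
  obtain ⟨L, hLd⟩ : ∃ L, L = logFactor n := ⟨_, rfl⟩
  obtain ⟨γ, hγ⟩ : ∃ γ, γ = gammaTilde 1000 (s * n) u := ⟨_, rfl⟩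
  rw [← hLd] at hL hQR hΔ ⊢
  rw [← hγ] at hgam hQR ⊢
  have hγ0 : 0 ≤ γ := by linarith
  have hL4 : 4 ≤ L := by linarith
  set x := ‖pinv Y‖ * ‖Δ‖ with hx
  have hx0 : 0 ≤ x := by positivity
  have hLx : L * x < 1 := by rw [hx, ← mul_assoc]; exact hΔ
  -- As `L ≥ 4`, the assumption on `Δ` forces `x < 1/4`; this is the source of the factors `4/3` and
  -- `5/4` below, and of their product `5/3` for the condition numbers.
  have hx4 : 4 * x ≤ L * x := by gcongr
  have hxΔ (z) : ‖WithLp.toLp 2 (Δ *ᵥ z)‖ ≤ x * ‖WithLp.toLp 2 (Y *ᵥ z)‖ := by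
    have h1 := norm_toLp_mulVec_le Δ z
    have h2 := mul_le_mul_of_nonneg_left (norm_le_norm_pinv_mul hY z) (norm_nonneg Δ)
    rw [hx]; linarith
  have hYΔ (z) : |‖WithLp.toLp 2 ((Y + Δ) *ᵥ z)‖ - ‖WithLp.toLp 2 (Y *ᵥ z)‖| ≤
      x * ‖WithLp.toLp 2 (Y *ᵥ z)‖ := by
    rw [Matrix.add_mulVec, WithLp.toLp_add]
    refine (abs_norm_sub_norm_le _ _).trans ?_
    rw [add_sub_cancel_left]
    exact hxΔ z
  have hlow (z) : ‖WithLp.toLp 2 (Y *ᵥ z)‖ ≤ 4 / 3 * ‖WithLp.toLp 2 ((Y + Δ) *ᵥ z)‖ := by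
    nlinarith [(abs_le.1 (hYΔ z)).1, norm_nonneg (WithLp.toLp 2 (Y *ᵥ z))]
  have hinv (z) : ‖WithLp.toLp 2 z‖ ≤ 4 / 3 * ‖pinv Y‖ * ‖WithLp.toLp 2 ((Y + Δ) *ᵥ z)‖ := by
    have := mul_le_mul_of_nonneg_left (hlow z) (norm_nonneg (pinv Y))
    linarith [norm_le_norm_pinv_mul hY z]
  have hYh : Function.Injective (Y + Δ).mulVec := mulVec_injective_of_norm_le hinv
  have hpinv : ‖pinv (Y + Δ)‖ ≤ 4 / 3 * ‖pinv Y‖ := norm_pinv_le (by positivity) hinv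
  have hnorm : ‖Y + Δ‖ ≤ 5 / 4 * ‖Y‖ := by
    refine norm_le_of_norm_toLp_mulVec_le (by positivity) fun z => ?_
    have h1 := norm_toLp_mulVec_le Y z
    nlinarith [(abs_le.1 (hYΔ z)).2, norm_nonneg (WithLp.toLp 2 (Y *ᵥ z))]
  have hκ : ‖Y + Δ‖ * ‖pinv (Y + Δ)‖ ≤ 5 / 3 * (‖Y‖ * ‖pinv Y‖) := by
    have := mul_le_mul hnorm hpinv (norm_nonneg _) (by positivity)
    linarith
  set κh := ‖Y + Δ‖ * ‖pinv (Y + Δ)‖ with hκh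
  set κ := ‖Y‖ * ‖pinv Y‖ with hκd
  have hκh0 : 0 ≤ κh := by positivity
  set y := 500 * τ * √n * κh with hy
  have hy0 : 0 ≤ y := by positivity
  -- `γ ≥ 1000 τ` and `L ≥ 4 √n` give `500 τ √n ≤ L γ / 8`. The assumption on `κ₂(Y + Δ)` then makes
  -- `y` small, while passing to `κ₂(Y)` gives the constant `5/24 = 1/8 · 5/3`.
  have hy1 : y ≤ 1 / 8 * (L * γ * κh) := by
    have h1 : 1000 * τ * (4 * √n) ≤ γ * L := mul_le_mul hgam hL (by positivity) hγ0
    have := mul_le_mul_of_nonneg_right h1 hκh0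
    rw [hy]; linarith
  have hy2 : y ≤ 5 / 24 * (L * γ * κ) := by
    have : L * γ * κh ≤ L * γ * (5 / 3 * κ) := by gcongr
    linarith
  have hRY (z) : |‖WithLp.toLp 2 (Rh *ᵥ z)‖ - ‖WithLp.toLp 2 ((Y + Δ) *ᵥ z)‖| ≤
      y * ‖WithLp.toLp 2 ((Y + Δ) *ᵥ z)‖ := by
    refine (hback z).trans ?_
    have h1 := mul_le_mul_of_nonneg_left (norm_le_norm_pinv_mul hYh z)
      (show 0 ≤ 500 * τ * (√n * ‖Y + Δ‖) by positivity)
    rw [hy, hκh]; linarith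
  have e1 : 18 * L * γ * κ = 18 * (L * γ * κ) := by ring
  have e2 : 2 * L * ‖pinv Y‖ * ‖Δ‖ = 2 * (L * x) := by rw [hx]; ring
  rw [e1, e2]
  obtain ⟨G, hG⟩ : ∃ G, G = L * γ * κ := ⟨_, rfl⟩
  rw [← hG] at hy2 ⊢
  have hG0 : 0 ≤ G := by linarith
  have hy8 : y ≤ 1 / 8 := by linarith
  have hX0 : 0 ≤ L * x := by linarith
  exact ⟨by linarith [mul_nonneg hG0 hX0], fun z => bounds_of_relative_errors hx0 hy0 hx4 hLx hy8
    hy2 (norm_nonneg _) (norm_nonneg _) (hYΔ z) (hRY z)⟩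

/-- Two square matrices whose images have comparable norms precondition `A` equally well. -/
theorem precondition_comparison {m n : ℕ} {A : Matrix (Fin m) (Fin n) ℝ}
    {R T : Matrix (Fin n) (Fin n) ℝ} {β : ℝ} (hA : Function.Injective A.mulVec) (hβ : 0 ≤ β)
    (hR : IsUnit R) (hT : IsUnit T)
    (h1 : ∀ z, ‖WithLp.toLp 2 (T *ᵥ z)‖ ≤ β * ‖WithLp.toLp 2 (R *ᵥ z)‖)
    (h2 : ∀ z, ‖WithLp.toLp 2 (R *ᵥ z)‖ ≤ β * ‖WithLp.toLp 2 (T *ᵥ z)‖) :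
    ‖A * T⁻¹‖ ≤ β * ‖A * R⁻¹‖ ∧ ‖pinv (A * T⁻¹)‖ ≤ β * ‖pinv (A * R⁻¹)‖ := by
  have hRd := (Matrix.isUnit_iff_isUnit_det _).1 hR
  have hTd := (Matrix.isUnit_iff_isUnit_det _).1 hT
  have eT (w) : T *ᵥ (T⁻¹ *ᵥ w) = w := by
    rw [Matrix.mulVec_mulVec, Matrix.mul_nonsing_inv _ hTd, Matrix.one_mulVec]
  have eA (z) : A *ᵥ z = (A * R⁻¹) *ᵥ (R *ᵥ z) := by
    rw [Matrix.mulVec_mulVec, Matrix.mul_assoc, Matrix.nonsing_inv_mul _ hRd, Matrix.mul_one]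
  have hinj : Function.Injective (A * R⁻¹).mulVec := by
    have : (A * R⁻¹).mulVec = A.mulVec ∘ R⁻¹.mulVec := by
      funext w; simp [Matrix.mulVec_mulVec]
    rw [this]
    exact hA.comp (Matrix.mulVec_injective_of_isUnit (Matrix.isUnit_nonsing_inv_iff.2 hR))
  constructor
  · refine norm_le_of_norm_toLp_mulVec_le (by positivity) fun w => ?_
    have h3 := h2 (T⁻¹ *ᵥ w)
    rw [eT] at h3
    rw [← Matrix.mulVec_mulVec, eA]
    refine (norm_toLp_mulVec_le _ _).trans ?_
    have := mul_le_mul_of_nonneg_left h3 (norm_nonneg (A * R⁻¹))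
    linarith
  · refine norm_pinv_le (by positivity) fun w => ?_
    have h3 := h1 (T⁻¹ *ᵥ w)
    rw [eT] at h3
    have h4 := norm_le_norm_pinv_mul hinj (R *ᵥ (T⁻¹ *ᵥ w))
    rw [← eA, Matrix.mulVec_mulVec w A] at h4
    have := mul_le_mul_of_nonneg_left h4 hβ
    linarith

end SketchQR
-- Assembly of the bounds for the computed factor and the preconditioned matrix
theorem corollary3p2 :
    -- `c` is the absolute constant hidden in `γ̃`
    ∃ c : ℝ, 0 < c ∧
    ∀ (m n s : ℕ) (hns : n ≤ s) (uS uQR : ℝ) (_ : 0 ≤ uS) (_ : 0 ≤ uQR)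
      (A As E : Matrix (Fin m) (Fin n) ℝ) (Ω : Matrix (Fin s) (Fin m) ℝ)
      (Qs : Matrix (Fin s) (Fin n) ℝ) (Rs : Matrix (Fin n) (Fin n) ℝ)
      (Yh Δs : Matrix (Fin s) (Fin n) ℝ) (Rh : Matrix (Fin n) (Fin n) ℝ),
      -- the matrix, its low precision version, and the exact QR decomposition of the sketch
      A.rank = n → As = A + E → ‖E‖ ≤ Real.sqrt n * uS * ‖A‖ → As.rank = n →
      (Ω * As).rank = n → SketchQR.IsEconomicQR (Ω * As) Qs Rs →
      -- the computed sketch and the computed `R`-factor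
      Yh = Ω * As + Δs → SketchQR.IsComputedRFactor hns uQR Yh Rh →
      -- the assumptions on the precisions (the first one makes `γ̃` meaningful)
      c * (s * n : ℕ) * uQR < 1 →
      SketchQR.logFactor n * SketchQR.gammaTilde c (s * n) uQR * SketchQR.cond2 Yh < 1 →
      SketchQR.logFactor n * ‖SketchQR.pinv (Ω * As)‖ * ‖Δs‖ < 1 →
      -- the conclusion
      IsUnit Rs ∧ IsUnit Rh ∧
      ∀ βs : ℝ, βs = SketchQR.amplification c uQR (Ω * As) Δs →
        ‖Rh‖ ≤ βs * ‖Ω * As‖ ∧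
        ‖Rh⁻¹‖ ≤ βs * ‖SketchQR.pinv (Ω * As)‖ ∧
        SketchQR.cond2 Rh ≤ βs ^ 2 * SketchQR.cond2 (Ω * As) ∧
        ‖A * Rh⁻¹‖ ≤ βs * ‖A * Rs⁻¹‖ ∧
        ‖SketchQR.pinv (A * Rh⁻¹)‖ ≤ βs * ‖SketchQR.pinv (A * Rs⁻¹)‖ ∧
        SketchQR.cond2 (A * Rh⁻¹) ≤ βs ^ 2 * SketchQR.cond2 (A * Rs⁻¹) := by

  -- With `c = 1000`, `c s n u < 1` yields the smallness used to absorb second-order terms, and `γ̃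
  -- ≥ 1000 s n u` dominates the backward error coefficient `500 s n u`.
  refine ⟨1000, by norm_num, ?_⟩
  rintro m n s hns uS u - hu A As E Ω Qs Rs Yh Δs Rh hA - - - hY hQR rfl hRh hsu hcond hΔ
  have hAi := SketchQR.mulVec_injective_of_rank_eq hA
  have hYi := SketchQR.mulVec_injective_of_rank_eq hY
  generalize Ω * As = Y at *
  obtain ⟨hβ1, hcmp⟩ := SketchQR.norm_comparison hu hYi hRh hsu hcond hΔ
  have hRs (z : Fin n → ℝ) : ‖WithLp.toLp 2 (Rs *ᵥ z)‖ = ‖WithLp.toLp 2 (Y *ᵥ z)‖ := by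
    rw [hQR.eq_mul, ← Matrix.mulVec_mulVec,
      SketchQR.norm_toLp_mulVec_of_orthonormal hQR.orthonormal]
  obtain ⟨β, hβ⟩ : ∃ β, β = SketchQR.amplification 1000 u Y Δs := ⟨_, rfl⟩
  rw [← hβ] at hβ1 hcmp
  have hβ0 : 0 ≤ β := by linarith
  have hRsi (z : Fin n → ℝ) :
      ‖WithLp.toLp 2 z‖ ≤ ‖SketchQR.pinv Y‖ * ‖WithLp.toLp 2 (Rs *ᵥ z)‖ := by
    rw [hRs]; exact SketchQR.norm_le_norm_pinv_mul hYi z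
  have hRhi (z : Fin n → ℝ) :
      ‖WithLp.toLp 2 z‖ ≤ β * ‖SketchQR.pinv Y‖ * ‖WithLp.toLp 2 (Rh *ᵥ z)‖ := by
    have := mul_le_mul_of_nonneg_left (hcmp z).2 (norm_nonneg (SketchQR.pinv Y))
    linarith [SketchQR.norm_le_norm_pinv_mul hYi z]
  have uRs : IsUnit Rs :=
    Matrix.mulVec_injective_iff_isUnit.1 (SketchQR.mulVec_injective_of_norm_le hRsi)
  have uRh : IsUnit Rh :=
    Matrix.mulVec_injective_iff_isUnit.1 (SketchQR.mulVec_injective_of_norm_le hRhi)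
  refine ⟨uRs, uRh, ?_⟩
  rintro βs rfl
  rw [← hβ]
  have b1 : ‖Rh‖ ≤ β * ‖Y‖ :=
    SketchQR.norm_le_of_norm_toLp_mulVec_le (by positivity) fun w => by
      have := mul_le_mul_of_nonneg_left (SketchQR.norm_toLp_mulVec_le Y w) hβ0
      linarith [(hcmp w).1]
  have b2 : ‖Rh⁻¹‖ ≤ β * ‖SketchQR.pinv Y‖ :=
    SketchQR.norm_le_of_norm_toLp_mulVec_le (by positivity) fun w => by
      have := hRhi (Rh⁻¹ *ᵥ w)
      rwa [Matrix.mulVec_mulVec,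
        Matrix.mul_nonsing_inv _ ((Matrix.isUnit_iff_isUnit_det _).1 uRh),
        Matrix.one_mulVec] at this
  -- `cond2` is defined through `pinv`; the lower bound `hRhi` controls it directly, without
  -- identifying `pinv Rh` with `Rh⁻¹`.
  have b3 : ‖SketchQR.pinv Rh‖ ≤ β * ‖SketchQR.pinv Y‖ :=
    SketchQR.norm_pinv_le (by positivity) hRhi
  obtain ⟨b4, b5⟩ := SketchQR.precondition_comparison hAi hβ0 uRs uRh
    (fun z => (hcmp z).1.trans_eq (by rw [hRs])) (fun z => (hRs z).trans_le (hcmp z).2)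
  have mulBound {a b c d : ℝ} (hab : a ≤ β * b) (hcd : c ≤ β * d) (hb : 0 ≤ b) (hc : 0 ≤ c) :
      a * c ≤ β ^ 2 * (b * d) :=
    (mul_le_mul hab hcd hc (by positivity)).trans_eq (by ring)
  exact ⟨b1, b2, mulBound b1 b3 (norm_nonneg _) (norm_nonneg _), b4, b5,
    mulBound b4 b5 (norm_nonneg _) (norm_nonneg _)⟩
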